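/- Let $V$ be a finite set of spins-$1/2$ and let $H=\sum_{\{a,b\}\subset V}h_{a,b}$ be a Hamiltonian on $(\mathbb C^2)^{\otimes V}$ whose terms $h_{a,b}$ act on pairs of spins and have ground energy zero, i.e. $h_{a,b}\ge 0$ and $\ker h_{a,b}\neq 0$. The interaction graph of $H$ has vertex set $V$ and an edge $ab$ for each non-zero term $h_{a,b}$. Assume that $H$ is natural, i.e. its interaction graph is connected and for every non-zero term $h_{a,b}$ there is an entangled (non-product) vector of $\mathbb C^2\otimes\mathbb C^2$ orthogonal to $\ker h_{a,b}$; and that $H$ is frustration-free, i.e. every vector $\Phi$ of the ground space $M$ of $H$ (the eigenspace of its least eigenvalue) satisfies $h_{a,b}\Phi=0$ for all $a,b$. Let $A\subset V$ be contiguous, i.e. the subgraph $G_A$ of the interaction graph induced on $A$ is connected, and let $H_A=\sum_{\{a,b\}\subset A}h_{a,b}$, acting on $(\mathbb C^2)^{\otimes A}$. Call an edge of $G_A$ heavy if its term has rank $2$ or $3$, and suppose that the graph on the vertex set $A$ formed by the heavy edges of $G_A$ has at most $\beta$ connected components. Let $M_A\subset(\mathbb C^2)^{\otimes A}$ be the span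 of the supports of the reduced states $\operatorname{tr}_{V\setminus A}|\Phi\rangle\langle\Phi|$, $\Phi\in M$. Then $$\log_2\dim\ker H_A\le\log_2(\beta+1),\qquad \log_2\dim M_A\le\log_2(\beta+1).$$ Moreover every non-zero $\Phi\in M$ has Schmidt measure ($\log_2$ of its Schmidt rank) at most $\log_2(\beta+1)$ across the cut $A\,|\,V\setminus A$, and for every density operator $\rho$ supported on $M$ and every $C\subset V$ disjoint from $A$, the entanglement of formation between $A$ and $C$ of the reduced state of $\rho$ on $A\cup C$ is at most $\log_2(\beta+1)$ e-bits. In particular, if all non-zero terms of $H$ have rank $2$ or $3$, then all these quantities are at most $1$: there is at most one e-bit of entanglement between a contiguous subsystem $A$ and the rest of the system, or any other subsystem disjoint from $A$. -/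

import Mathlib

open scoped ComplexOrder

noncomputable section

/-- A two-spin vector `ψ ∈ ℂ² ⊗ ℂ²` is entangled if it is not a product vector. -/
def IsEntangled (ψ : Fin 2 × Fin 2 → ℂ) : Prop :=
  ¬ ∃ α β : Fin 2 → ℂ, ∀ i j, ψ (i, j) = α i * β j

/-- The operator on `(ℂ²)^{⊗ V}` that acts as the two-spin operator `M` on the spins `a`, `b`
(first factor on `a`, second factor on `b`, where `a ≠ b`) and as the identity elsewhere. -/
def embedPair {V : Type*} [Fintype V] [DecidableEq V] (a b : V)
    (M : Matrix (Fin 2 × Fin 2) (Fin 2 × Fin 2) ℂ) : Matrix (V → Fin 2) (V → Fin 2) ℂ :=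
  fun x y => if ∀ c, c ≠ a → c ≠ b → x c = y c then M (x a, x b) (y a, y b) else 0

/-- The two-spin terms of a Hamiltonian `∑_{a,b} h_{a,b}` (sum over unordered pairs) on the set
of spins `V`. The operator `h_{a,b}` is written with the tensor factors in the order `a, b`, so
that `h_{b,a}` is the same operator with the two factors exchanged. -/
structure PairHamiltonian (V : Type*) where
  term : V → V → Matrix (Fin 2 × Fin 2) (Fin 2 × Fin 2) ℂ
  term_self : ∀ a, term a a = 0
  term_symm : ∀ a b, term b a = (term a b).submatrix Prod.swap Prod.swap

namespace PairHamiltonian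

variable {V : Type*}

/-- The Hamiltonian `H_A` of all terms internal to `A`, on the spins of `A`. -/
def restrict (H : PairHamiltonian V) (A : Finset V) : PairHamiltonian A where
  term a b := H.term a b
  term_self a := H.term_self a
  term_symm a b := H.term_symm a b

theorem embedPair_term_comm [Fintype V] [DecidableEq V] (H : PairHamiltonian V) (a b : V) :
    embedPair a b (H.term a b) = embedPair b a (H.term b a) := by
  ext x y
  rw [H.term_symm a b]
  simp only [embedPair, Matrix.submatrix_apply, Prod.swap_prod_mk]
  congr 1
  exact propext ⟨fun h c hb ha => h c ha hb, fun h c ha hb => h c hb ha⟩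

/-- The operator `H = ∑_{a,b} h_{a,b}` on `(ℂ²)^{⊗ V}`, each unordered pair counted once. -/
def op [Fintype V] [DecidableEq V] (H : PairHamiltonian V) : Matrix (V → Fin 2) (V → Fin 2) ℂ :=
  ∑ e : Sym2 V,
    Sym2.lift ⟨fun a b => embedPair a b (H.term a b), H.embedPair_term_comm⟩ e

/-- The interaction graph: an edge for each non-zero term. -/
def interactionGraph (H : PairHamiltonian V) : SimpleGraph V where
  Adj a b := H.term a b ≠ 0
  symm := ⟨by
    intro a b h h0
    apply h
    rw [H.term_symm b a, h0]
    rfl⟩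
  loopless := ⟨fun a h => h (H.term_self a)⟩

theorem rank_term_comm (H : PairHamiltonian V) (a b : V) :
    (H.term b a).rank = (H.term a b).rank := by
  rw [H.term_symm a b]
  exact Matrix.rank_submatrix (H.term a b) (Equiv.prodComm _ _) (Equiv.prodComm _ _)

/-- The subgraph of heavy edges: those whose term has rank `2` or `3`. -/
def heavyGraph (H : PairHamiltonian V) : SimpleGraph V where
  Adj a b := (H.term a b).rank = 2 ∨ (H.term a b).rank = 3
  symm := ⟨by
    intro a b h
    rwa [H.rank_term_comm a b]⟩
  loopless := ⟨by
    intro a h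
    simp [H.term_self a] at h⟩

/-- Natural Hamiltonians: each term has ground energy zero, there are no isolated subsystems, and
each (non-zero) term has an entangled excited state, that is an entangled vector orthogonal to its
ground space. -/
structure IsNatural (H : PairHamiltonian V) : Prop where
  posSemidef : ∀ a b, (H.term a b).PosSemidef
  ground_energy_zero : ∀ a b, ∃ φ : Fin 2 × Fin 2 → ℂ, φ ≠ 0 ∧ (H.term a b).mulVec φ = 0
  not_isolated : H.interactionGraph.Preconnected
  entangled_excited : ∀ a b, H.term a b ≠ 0 →
    ∃ ψ : Fin 2 × Fin 2 → ℂ, IsEntangled ψ ∧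
      ∀ φ, (H.term a b).mulVec φ = 0 → star φ ⬝ᵥ ψ = 0

/-- The least eigenvalue of a Hermitian matrix. -/
def groundEnergy {n : Type*} [Fintype n] (M : Matrix n n ℂ) : ℝ :=
  sInf {E : ℝ | ∃ Φ : n → ℂ, Φ ≠ 0 ∧ M.mulVec Φ = (E : ℂ) • Φ}

/-- The ground state manifold: the eigenspace of the least eigenvalue of `H`. -/
def groundSpace [Fintype V] [DecidableEq V] (H : PairHamiltonian V) :
    Submodule ℂ ((V → Fin 2) → ℂ) :=
  LinearMap.ker (H.op.mulVecLin - (groundEnergy H.op : ℂ) • LinearMap.id)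

/-- Every ground state vector of `H` is annihilated by every term, i.e. is a ground state of each
of the terms (whose ground energies are zero). -/
def IsFrustrationFree [Fintype V] [DecidableEq V] (H : PairHamiltonian V) : Prop :=
  ∀ Φ ∈ H.groundSpace, ∀ a b, (embedPair a b (H.term a b)).mulVec Φ = 0

/-- Any two spins of `A` are joined by a path of interaction edges inside `A`. -/
def IsContiguous (H : PairHamiltonian V) (A : Finset V) : Prop :=
  (H.restrict A).interactionGraph.Preconnected

/-- The number of connected components of the heavy subgraph of the interaction graph of `H_A`
(a spin of `A` without heavy edges inside `A` is a component by itself). -/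
def heavyComponents (H : PairHamiltonian V) (A : Finset V) : ℕ :=
  Nat.card (H.restrict A).heavyGraph.ConnectedComponent

end PairHamiltonian

/-! ### Bipartite entanglement -/

section Bipartite

variable {m n : Type*} [Fintype m] [DecidableEq m] [Fintype n]

/-- The coefficient matrix of a bipartite vector. -/
def coeffMatrix (ψ : m × n → ℂ) : Matrix m n ℂ := fun i j => ψ (i, j)

/-- The Schmidt measure of a bipartite vector: `log₂` of its Schmidt rank. -/
def schmidtMeasure (ψ : m × n → ℂ) : ℝ := Real.logb 2 (coeffMatrix ψ).rank

/-- The entanglement entropy of a bipartite unit vector, in e-bits: the von Neumann entropy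
`- ∑ λ log₂ λ` of its reduced state on the first factor. -/
def entanglementEntropy (ψ : m × n → ℂ) : ℝ :=
  ∑ i, Real.negMulLog
    ((Matrix.isHermitian_mul_conjTranspose_self (coeffMatrix ψ)).eigenvalues i) / Real.log 2

/-- The entanglement of formation of a bipartite state: the infimum of the average entanglement
entropy over all finite decompositions into pure states. -/
def entanglementOfFormation (ρ : Matrix (m × n) (m × n) ℂ) : ℝ :=
  sInf {s : ℝ | ∃ (k : ℕ) (p : Fin k → ℝ) (ψ : Fin k → m × n → ℂ),
    (∀ i, 0 ≤ p i) ∧ ∑ i, p i = 1 ∧ (∀ i, star (ψ i) ⬝ᵥ ψ i = 1) ∧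
    ρ = ∑ i, (p i : ℂ) • Matrix.vecMulVec (ψ i) (star (ψ i)) ∧
    s = ∑ i, p i * entanglementEntropy (ψ i)}

end Bipartite

/-! ### Subsystems of spins -/

section Subsystems

variable {V : Type*} [Fintype V] [DecidableEq V]

/-- A vector on `V` as a bipartite vector on `A` and its complement. -/
def cut (A : Finset V) (Φ : (V → Fin 2) → ℂ) :
    (A → Fin 2) × ({v : V // v ∉ A} → Fin 2) → ℂ :=
  fun p => Φ fun v => if h : v ∈ A then p.1 ⟨v, h⟩ else p.2 ⟨v, h⟩

/-- The reduction to `A` of a space `M` of state vectors: the span of the supports of all reduced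
states `tr_{V \ A} |Φ⟩⟨Φ|`, `Φ ∈ M`. (The support of such a reduced state is the column space of
the coefficient matrix of `Φ`.) -/
def reducedSpace (A : Finset V) (M : Submodule ℂ ((V → Fin 2) → ℂ)) :
    Submodule ℂ ((A → Fin 2) → ℂ) :=
  ⨆ Φ ∈ M, LinearMap.range (coeffMatrix (cut A Φ)).mulVecLin

/-- The configuration of `V` that is `p.1` on `A`, `p.2` on `C` and `z` on the other spins. -/
def glue (A C : Finset V) (p : (A → Fin 2) × (C → Fin 2))
    (z : {v : V // v ∉ A ∧ v ∉ C} → Fin 2) : V → Fin 2 :=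
  fun v => if hA : v ∈ A then p.1 ⟨v, hA⟩
    else if hC : v ∈ C then p.2 ⟨v, hC⟩ else z ⟨v, hA, hC⟩

/-- The reduced state on `A ∪ C`, for disjoint `A` and `C`, as a bipartite state on `A` and `C`:
all the other spins are traced out. -/
def reducedState (A C : Finset V) (ρ : Matrix (V → Fin 2) (V → Fin 2) ℂ) :
    Matrix ((A → Fin 2) × (C → Fin 2)) ((A → Fin 2) × (C → Fin 2)) ℂ :=
  fun p q => ∑ z, ρ (glue A C p z) (glue A C q z)

/-- A density operator supported on the space `M` (the pure states of `M` and the maximally mixed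
state over `M` are examples). -/
structure IsStateOn (M : Submodule ℂ ((V → Fin 2) → ℂ))
    (ρ : Matrix (V → Fin 2) (V → Fin 2) ℂ) : Prop where
  posSemidef : ρ.PosSemidef
  trace_one : ρ.trace = 1
  support : ∀ φ, ρ.mulVec φ ∈ M

end Subsystems

end

/-!
Let `K` be a space of vectors on which the functional of an entangled excited state of each
non-zero term vanishes. Writing such a functional as an invertible `2 × 2` matrix, two constraints
along `a`, `b` and `b`, `c` glue to one along `a`, `c`, again invertible, so on a connected set
every pair of spins carries an invertible constraint. By the same gluing, a vector of `K` that a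
covector on one spin annihilates is annihilated by a covector on every spin, so such vectors form a
space of dimension at most `1`. Hence contracting one spin with any covector lowers the
dimension by at most `1`, and on `k` spins `dim K ≤ k + 1`.

A term of rank at least `2` has at least a pencil of constraints, and a pencil of `2 × 2` matrices
contains a singular one, i.e. a product constraint `α ⊗ β`. Contracting one of its spins with `β`
leaves a space annihilated by `α`, so `dim K ≤ 2` as soon as there is one heavy edge.

Frustration-freeness places the supports of the reduced ground states in `ker H_A`. This bounds
their Schmidt ranks, and the entanglement entropy is at most `log₂` of the Schmidt rank.
-/

/-! ### Contraction of sites -/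

section Contraction

variable {W κ R : Type*} [DecidableEq W] [CommRing R]

/-- The slice of a tensor `Φ` with one index for each site of `W` at which the index of the site `v`
equals `i`. It is kept as a tensor on all of `W`, one that ignores the site `v`, so that slices at
different sites can be composed. -/
def sliceSite (v : W) (i : κ) : ((W → κ) → R) →ₗ[R] ((W → κ) → R) :=
  LinearMap.funLeft R R fun x => Function.update x v i

theorem sliceSite_apply (v : W) (i : κ) (Φ : (W → κ) → R) (x : W → κ) :
    sliceSite v i Φ x = Φ (Function.update x v i) := rfl

theorem sliceSite_comm {v w : W} (hvw : v ≠ w) (i j : κ) (Φ : (W → κ) → R) :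
    sliceSite v i (sliceSite w j Φ) = sliceSite w j (sliceSite v i Φ) :=
  funext fun x => congrArg Φ (Function.update_comm hvw i j x)

theorem eq_zero_of_sliceSite_eq_zero {v : W} {Φ : (W → κ) → R}
    (h : ∀ i, sliceSite v i Φ = 0) : Φ = 0 := by
  ext x
  calc Φ x = sliceSite v (x v) Φ x := by rw [sliceSite_apply, Function.update_eq_self]
    _ = 0 := by rw [h, Pi.zero_apply]

theorem dependsOn_sliceSite {S : Finset W} {Φ : (W → κ) → R} (hΦ : DependsOn Φ (S : Set W))
    (v : W) (i : κ) : DependsOn (sliceSite v i Φ) (S.erase v : Set W) :=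
  fun _ _ hxy => hΦ.update v i hxy

variable [Fintype κ]

/-- The contraction of the site `v` of a tensor with the covector `α`. -/
def contractSite (v : W) (α : κ → R) : ((W → κ) → R) →ₗ[R] ((W → κ) → R) :=
  ∑ i, α i • sliceSite v i

/-- The contraction of the sites `a` and `b` of a tensor with the bilinear form `M`. -/
def contractPair (a b : W) (M : Matrix κ κ R) : ((W → κ) → R) →ₗ[R] ((W → κ) → R) :=
  ∑ i, ∑ j, M i j • (sliceSite a i ∘ₗ sliceSite b j)

theorem contractSite_apply (v : W) (α : κ → R) (Φ : (W → κ) → R) :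
    contractSite v α Φ = ∑ i, α i • sliceSite v i Φ := by
  simp only [contractSite, LinearMap.sum_apply, LinearMap.smul_apply]

theorem contractPair_apply (a b : W) (M : Matrix κ κ R) (Φ : (W → κ) → R) :
    contractPair a b M Φ = ∑ i, ∑ j, M i j • sliceSite a i (sliceSite b j Φ) := by
  simp only [contractPair, LinearMap.sum_apply, LinearMap.smul_apply, LinearMap.comp_apply]

theorem contractPair_vecMulVec (a b : W) (α β : κ → R) (Φ : (W → κ) → R) :
    contractPair a b (Matrix.vecMulVec α β) Φ = contractSite a α (contractSite b β Φ) := by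
  rw [contractSite_apply a, contractSite_apply b]
  simp only [contractPair_apply, map_sum, map_smul, Finset.smul_sum, smul_smul,
    Matrix.vecMulVec_apply]

theorem contractSite_sliceSite {v w : W} (hvw : v ≠ w) (α : κ → R) (i : κ) (Φ : (W → κ) → R) :
    contractSite v α (sliceSite w i Φ) = sliceSite w i (contractSite v α Φ) := by
  simp only [contractSite_apply, map_sum, map_smul, sliceSite_comm hvw]

theorem contractPair_sliceSite {a b w : W} (ha : a ≠ w) (hb : b ≠ w) (M : Matrix κ κ R) (i : κ)
    (Φ : (W → κ) → R) :
    contractPair a b M (sliceSite w i Φ) = sliceSite w i (contractPair a b M Φ) := by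
  simp only [contractPair_apply, map_sum, map_smul, sliceSite_comm hb, sliceSite_comm ha]

theorem contractPair_contractSite {a b w : W} (ha : a ≠ w) (hb : b ≠ w) (M : Matrix κ κ R)
    (α : κ → R) (Φ : (W → κ) → R) :
    contractPair a b M (contractSite w α Φ) = contractSite w α (contractPair a b M Φ) := by
  simp only [contractSite_apply, map_sum, map_smul, contractPair_sliceSite ha hb]

theorem dependsOn_contractSite {S : Finset W} {Φ : (W → κ) → R} (hΦ : DependsOn Φ (S : Set W))
    (v : W) (α : κ → R) : DependsOn (contractSite v α Φ) (S.erase v : Set W) := by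
  intro x y hxy
  simp only [contractSite_apply, Finset.sum_apply, Pi.smul_apply]
  exact Finset.sum_congr rfl fun i _ => congrArg (α i • ·) (dependsOn_sliceSite hΦ v i hxy)

end Contraction

/-! ### Gluing of two-spin constraints -/

section Gluing

variable {R : Type*} [CommRing R]

variable (R) in
/-- The alternating bilinear form on `R²`, which glues two constraints along a common spin. -/
def alternatingForm : Matrix (Fin 2) (Fin 2) R := !![0, 1; -1, 0]

theorem det_alternatingForm : (alternatingForm R).det = 1 := by
  simp [alternatingForm]

theorem sum_mul_alternatingForm_mul_smul_eq_zero {m n E : Type*} [Fintype m] [Fintype n]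
    [AddCommGroup E] [Module R E] {M : Matrix m (Fin 2) R} {N : Matrix (Fin 2) n R}
    {T : m → Fin 2 → n → E} (hM : ∀ k, ∑ i, ∑ j, M i j • T i j k = 0)
    (hN : ∀ i, ∑ j, ∑ k, N j k • T i j k = 0) (j : Fin 2) :
    ∑ i, ∑ k, (M * alternatingForm R * N) i k • T i j k = 0 := by
  -- The Plücker relation `ε p q * t j = ε j q * t p + ε p j * t q` moves the index `j` off `T`.
  have plucker (i : m) (k : n) : (M * alternatingForm R * N) i k • T i j k =
      (alternatingForm R * N) j k • ∑ p, M i p • T i p k +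
        (M * alternatingForm R) i j • ∑ q, N q k • T i q k := by
    fin_cases j <;>
      simp only [alternatingForm, Matrix.mul_apply, Fin.sum_univ_two, Matrix.of_apply,
        Matrix.cons_val', Matrix.cons_val_zero, Matrix.cons_val_one, Matrix.cons_val_fin_one,
        Fin.zero_eta, Fin.mk_one] <;>
      module
  calc ∑ i, ∑ k, (M * alternatingForm R * N) i k • T i j k
      = ∑ k, (alternatingForm R * N) j k • ∑ i, ∑ p, M i p • T i p k +
          ∑ i, (M * alternatingForm R) i j • ∑ q, ∑ k, N q k • T i q k := by
        simp only [plucker, Finset.sum_add_distrib, ← Finset.smul_sum]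
        congr 1
        · rw [Finset.sum_comm]
          simp only [Finset.smul_sum]
        · exact Finset.sum_congr rfl fun i _ => congrArg _ Finset.sum_comm
    _ = 0 := by simp only [hM, hN, smul_zero, Finset.sum_const_zero, add_zero]

variable {W : Type*} [DecidableEq W]

theorem contractPair_mul_alternatingForm_mul_eq_zero {a b c : W} (hab : a ≠ b) (hbc : b ≠ c)
    (hac : a ≠ c) {M N : Matrix (Fin 2) (Fin 2) R} {Φ : (W → Fin 2) → R}
    (hM : contractPair a b M Φ = 0) (hN : contractPair b c N Φ = 0) :
    contractPair a c (M * alternatingForm R * N) Φ = 0 := by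
  refine eq_zero_of_sliceSite_eq_zero (v := b) fun j => ?_
  rw [← contractPair_sliceSite hab hbc.symm, contractPair_apply]
  simp only [sliceSite_comm hbc.symm]
  refine sum_mul_alternatingForm_mul_smul_eq_zero
    (T := fun i j k => sliceSite a i (sliceSite b j (sliceSite c k Φ)))
    (fun k => ?_) (fun i => ?_) j
  · rw [← contractPair_apply, contractPair_sliceSite hac hbc, hM, map_zero]
  · simpa only [contractPair_apply, map_sum, map_smul, map_zero] using congrArg (sliceSite a i) hN

theorem contractSite_vecMul_alternatingForm_mul_eq_zero {a b : W} (hab : a ≠ b) {α : Fin 2 → R}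
    {M : Matrix (Fin 2) (Fin 2) R} {Φ : (W → Fin 2) → R} (hα : contractSite a α Φ = 0)
    (hM : contractPair a b M Φ = 0) :
    contractSite b (Matrix.vecMul α (alternatingForm R * M)) Φ = 0 := by
  refine eq_zero_of_sliceSite_eq_zero (v := a) fun i => ?_
  rw [← contractSite_sliceSite hab.symm, contractSite_apply]
  simp only [sliceSite_comm hab.symm]
  have h := sum_mul_alternatingForm_mul_smul_eq_zero (M := Matrix.replicateRow Unit α) (N := M)
    (T := fun _ i j => sliceSite a i (sliceSite b j Φ)) (fun j => ?_) (fun _ => ?_) i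
  · simpa only [Finset.univ_unique, Finset.sum_singleton, Matrix.mul_assoc,
      ← Matrix.vecMul_vecMul, ← Matrix.replicateRow_vecMul, Matrix.replicateRow_apply] using h
  · simpa only [Finset.univ_unique, Finset.sum_singleton, Matrix.replicateRow_apply,
      ← contractSite_apply, contractSite_sliceSite hab, map_zero] using congrArg (sliceSite b j) hα
  · rw [← contractPair_apply, hM]

end Gluing

/-! ### Spaces constrained on every pair of spins -/

section Constrained

theorem finrank_le_finrank_inf_ker_add_finrank_map {𝕜 E F : Type*} [DivisionRing 𝕜]
    [AddCommGroup E] [Module 𝕜 E] [AddCommGroup F] [Module 𝕜 F] (K : Submodule 𝕜 E)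
    [FiniteDimensional 𝕜 K] (f : E →ₗ[𝕜] F) :
    Module.finrank 𝕜 K ≤
      Module.finrank 𝕜 (K ⊓ LinearMap.ker f : Submodule 𝕜 E) + Module.finrank 𝕜 (K.map f) := by
  rw [← LinearMap.finrank_range_add_finrank_ker (f.domRestrict K), LinearMap.range_domRestrict,
    LinearMap.ker_domRestrict, add_comm, ← Submodule.map_comap_subtype]
  exact Nat.add_le_add_right (LinearEquiv.finrank_eq
    (Submodule.equivMapOfInjective K.subtype K.injective_subtype _)).le _

theorem finrank_le_one_of_dependsOn_empty {W κ 𝕜 : Type*} [Nonempty κ] [DivisionRing 𝕜]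
    {K : Submodule 𝕜 ((W → κ) → 𝕜)} (hK : ∀ Φ ∈ K, DependsOn Φ ∅) : Module.finrank 𝕜 K ≤ 1 := by
  have hle : K ≤ 𝕜 ∙ (1 : (W → κ) → 𝕜) := fun Φ hΦ => Submodule.mem_span_singleton.mpr
    ⟨Φ (Classical.arbitrary _), funext fun x => by simpa using (hK Φ hΦ).empty _ x⟩
  exact (Submodule.finrank_mono hle).trans (finrank_span_le_card _ |>.trans (by simp))

variable {W 𝕜 : Type*} [DecidableEq W] [Field 𝕜]

/-- A space of vectors that depend only on the spins of `S`, each pair of which carries an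
invertible bilinear form whose contraction annihilates the space. -/
structure IsPairConstrained (S : Finset W) (K : Submodule 𝕜 ((W → Fin 2) → 𝕜)) : Prop where
  dependsOn : ∀ Φ ∈ K, DependsOn Φ (S : Set W)
  exists_le_ker : ∀ a ∈ S, ∀ b ∈ S, a ≠ b →
    ∃ M : Matrix (Fin 2) (Fin 2) 𝕜, M.det ≠ 0 ∧ K ≤ LinearMap.ker (contractPair a b M)

theorem IsPairConstrained.mono {S : Finset W} {K K' : Submodule 𝕜 ((W → Fin 2) → 𝕜)}
    (hK : IsPairConstrained S K) (hle : K' ≤ K) : IsPairConstrained S K' where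
  dependsOn Φ hΦ := hK.dependsOn Φ (hle hΦ)
  exists_le_ker a ha b hb hab :=
    (hK.exists_le_ker a ha b hb hab).imp fun _ hM => ⟨hM.1, hle.trans hM.2⟩

theorem IsPairConstrained.map_contractSite {S : Finset W} {K : Submodule 𝕜 ((W → Fin 2) → 𝕜)}
    (hK : IsPairConstrained S K) (b : W) (β : Fin 2 → 𝕜) :
    IsPairConstrained (S.erase b) (K.map (contractSite b β)) where
  dependsOn := by
    rintro _ ⟨Φ, hΦ, rfl⟩
    exact dependsOn_contractSite (hK.dependsOn Φ hΦ) b β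
  exists_le_ker a ha c hc hac := by
    obtain ⟨hab, ha⟩ := Finset.mem_erase.mp ha
    obtain ⟨hcb, hc⟩ := Finset.mem_erase.mp hc
    obtain ⟨M, hdet, hM⟩ := hK.exists_le_ker a ha c hc hac
    refine ⟨M, hdet, ?_⟩
    rintro _ ⟨Φ, hΦ, rfl⟩
    rw [LinearMap.mem_ker, contractPair_contractSite hab hcb, LinearMap.mem_ker.mp (hM hΦ),
      map_zero]

theorem isPairConstrained_of_preconnected [Fintype W] {K : Submodule 𝕜 ((W → Fin 2) → 𝕜)}
    {G : SimpleGraph W} (hG : G.Preconnected)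
    (hK : ∀ a b, G.Adj a b →
      ∃ M : Matrix (Fin 2) (Fin 2) 𝕜, M.det ≠ 0 ∧ K ≤ LinearMap.ker (contractPair a b M)) :
    IsPairConstrained Finset.univ K := by
  refine ⟨fun Φ _ => by simpa using dependsOn_univ Φ, fun a _ b _ hab => ?_⟩
  obtain ⟨p⟩ := hG a b
  induction p with
  | nil => exact absurd rfl hab
  | @cons a c b hac p ih =>
    obtain ⟨M, hdetM, hM⟩ := hK a c hac
    rcases eq_or_ne c b with rfl | hcb
    · exact ⟨M, hdetM, hM⟩
    obtain ⟨N, hdetN, hN⟩ := ih (Finset.mem_univ c) (Finset.mem_univ b) hcb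
    refine ⟨M * alternatingForm 𝕜 * N, ?_, fun Φ hΦ =>
      contractPair_mul_alternatingForm_mul_eq_zero hac.ne hcb hab (hM hΦ) (hN hΦ)⟩
    rw [Matrix.det_mul, Matrix.det_mul, det_alternatingForm, mul_one]
    exact mul_ne_zero hdetM hdetN

theorem eq_zero_of_contractSite_eq_zero_of_sliceSite_eq_zero {v : W} {α : Fin 2 → 𝕜} {i j : Fin 2}
    (hij : j ≠ i) (hi : α i ≠ 0) {Φ : (W → Fin 2) → 𝕜} (hα : contractSite v α Φ = 0)
    (hj : sliceSite v j Φ = 0) : Φ = 0 := by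
  have hslice : sliceSite v i Φ = 0 := by
    rw [contractSite_apply, Fintype.sum_eq_add i j hij.symm (by omega), hj, smul_zero,
      add_zero] at hα
    exact (smul_eq_zero.mp hα).resolve_left hi
  refine eq_zero_of_sliceSite_eq_zero (v := v) fun k => ?_
  obtain rfl | rfl : k = i ∨ k = j := by omega
  exacts [hslice, hj]

theorem finrank_le_one_of_le_ker_contractSite [Finite W] {S : Finset W}
    {K : Submodule 𝕜 ((W → Fin 2) → 𝕜)} (hdep : ∀ Φ ∈ K, DependsOn Φ (S : Set W))
    (hK : ∀ v ∈ S, ∃ α : Fin 2 → 𝕜, α ≠ 0 ∧ K ≤ LinearMap.ker (contractSite v α)) :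
    Module.finrank 𝕜 K ≤ 1 := by
  induction S using Finset.induction_on generalizing K with
  | empty => exact finrank_le_one_of_dependsOn_empty (by simpa using hdep)
  | insert v S hv ih =>
    obtain ⟨α, hα, hαK⟩ := hK v (Finset.mem_insert_self v S)
    obtain ⟨i, hi⟩ := Function.ne_iff.mp hα
    obtain ⟨j, hij⟩ := exists_ne i
    have hker : K ⊓ LinearMap.ker (sliceSite v j) = ⊥ := (Submodule.eq_bot_iff _).mpr fun Φ hΦ =>
      eq_zero_of_contractSite_eq_zero_of_sliceSite_eq_zero hij hi (hαK hΦ.1) hΦ.2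
    have hmap : Module.finrank 𝕜 (K.map (sliceSite v j)) ≤ 1 := by
      refine ih ?_ fun w hw => ?_
      · rintro _ ⟨Φ, hΦ, rfl⟩
        simpa only [Finset.erase_insert hv] using dependsOn_sliceSite (hdep Φ hΦ) v j
      · obtain ⟨γ, hγ, hγK⟩ := hK w (Finset.mem_insert_of_mem hw)
        refine ⟨γ, hγ, ?_⟩
        rintro _ ⟨Φ, hΦ, rfl⟩
        rw [LinearMap.mem_ker, contractSite_sliceSite (ne_of_mem_of_not_mem hw hv),
          LinearMap.mem_ker.mp (hγK hΦ), map_zero]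
    have hsplit := finrank_le_finrank_inf_ker_add_finrank_map K (sliceSite v j)
    rw [hker, finrank_bot, zero_add] at hsplit
    exact hsplit.trans hmap

theorem IsPairConstrained.finrank_le_one [Finite W] {S : Finset W}
    {K : Submodule 𝕜 ((W → Fin 2) → 𝕜)} (hK : IsPairConstrained S K) {a : W} (ha : a ∈ S)
    {α : Fin 2 → 𝕜} (hα : α ≠ 0) (hKα : K ≤ LinearMap.ker (contractSite a α)) :
    Module.finrank 𝕜 K ≤ 1 := by
  refine finrank_le_one_of_le_ker_contractSite hK.dependsOn fun v hv => ?_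
  rcases eq_or_ne a v with rfl | hav
  · exact ⟨α, hα, hKα⟩
  obtain ⟨M, hdet, hM⟩ := hK.exists_le_ker a ha v hv hav
  refine ⟨_, fun h => hα ?_, fun Φ hΦ =>
    contractSite_vecMul_alternatingForm_mul_eq_zero hav (hKα hΦ) (hM hΦ)⟩
  exact Matrix.eq_zero_of_vecMul_eq_zero
    (by rwa [Matrix.det_mul, det_alternatingForm, one_mul]) h

theorem IsPairConstrained.finrank_le_finrank_map_add_one [Finite W] {S : Finset W}
    {K : Submodule 𝕜 ((W → Fin 2) → 𝕜)} (hK : IsPairConstrained S K) {b : W} (hb : b ∈ S)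
    {β : Fin 2 → 𝕜} (hβ : β ≠ 0) :
    Module.finrank 𝕜 K ≤ Module.finrank 𝕜 (K.map (contractSite b β)) + 1 := by
  have hker := (hK.mono inf_le_left).finrank_le_one hb hβ
    (inf_le_right : K ⊓ LinearMap.ker (contractSite b β) ≤ _)
  have hsplit := finrank_le_finrank_inf_ker_add_finrank_map K (contractSite b β)
  omega

theorem IsPairConstrained.finrank_le_card_add_one [Finite W] {S : Finset W}
    {K : Submodule 𝕜 ((W → Fin 2) → 𝕜)} (hK : IsPairConstrained S K) :
    Module.finrank 𝕜 K ≤ S.card + 1 := by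
  induction S using Finset.induction_on generalizing K with
  | empty => simpa using finrank_le_one_of_dependsOn_empty (by simpa using hK.dependsOn)
  | insert b S hb ih =>
    have hmap := hK.map_contractSite b (Pi.single 0 1)
    rw [Finset.erase_insert hb] at hmap
    rw [Finset.card_insert_of_notMem hb]
    exact (hK.finrank_le_finrank_map_add_one (Finset.mem_insert_self b S)
      (Pi.single_ne_zero_iff.mpr one_ne_zero)).trans (Nat.add_le_add_right (ih hmap) 1)

theorem IsPairConstrained.finrank_le_two [Finite W] {S : Finset W}
    {K : Submodule 𝕜 ((W → Fin 2) → 𝕜)} (hK : IsPairConstrained S K) {a b : W} (ha : a ∈ S)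
    (hb : b ∈ S) (hab : a ≠ b) {α β : Fin 2 → 𝕜} (hα : α ≠ 0) (hβ : β ≠ 0)
    (hKαβ : K ≤ LinearMap.ker (contractPair a b (Matrix.vecMulVec α β))) :
    Module.finrank 𝕜 K ≤ 2 := by
  have hmap := (hK.map_contractSite b β).finrank_le_one (Finset.mem_erase.mpr ⟨hab, ha⟩) hα (by
    rintro _ ⟨Φ, hΦ, rfl⟩
    rw [LinearMap.mem_ker, ← contractPair_vecMulVec]
    exact hKαβ hΦ)
  exact (hK.finrank_le_finrank_map_add_one hb hβ).trans (Nat.add_le_add_right hmap 1)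

end Constrained

/-! ### Two-spin functionals -/

section TwoSpin

theorem exists_eq_vecMulVec_of_rank_le_one {m n 𝕜 : Type*} [Finite m] [Fintype n] [Field 𝕜]
    {M : Matrix m n 𝕜} (hM : M.rank ≤ 1) : ∃ α β, M = Matrix.vecMulVec α β := by
  classical
  obtain ⟨v, hv⟩ := finrank_le_one_iff.mp hM
  choose c hc using fun j => hv ⟨M.col j, Pi.single j 1, M.mulVec_single_one j⟩
  refine ⟨v, c, Matrix.ext fun i j => ?_⟩
  rw [Matrix.vecMulVec_apply, mul_comm]
  exact (congrFun (congrArg Subtype.val (hc j)) i).symm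

theorem rank_lt_card_of_det_eq_zero {n 𝕜 : Type*} [Fintype n] [DecidableEq n] [Field 𝕜]
    {M : Matrix n n 𝕜} (hM : M.det = 0) : M.rank < Fintype.card n := by
  refine M.rank_le_card_width.lt_of_ne fun hrank => ?_
  have hsurj : Function.Surjective M.mulVec := LinearMap.range_eq_top.mp
    (Submodule.eq_top_of_finrank_eq (hrank.trans (Module.finrank_fintype_fun_eq_card 𝕜).symm))
  exact ((Matrix.isUnit_iff_isUnit_det M).mp
    (Matrix.mulVec_surjective_iff_isUnit.mp hsurj)).ne_zero hM

theorem exists_mem_ne_zero_and_det_eq_zero {n 𝕜 : Type*} [Fintype n] [DecidableEq n] [Nonempty n]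
    [Field 𝕜] [IsAlgClosed 𝕜] {K : Submodule 𝕜 (Matrix n n 𝕜)} (hK : 1 < Module.finrank 𝕜 K) :
    ∃ M ∈ K, M ≠ 0 ∧ M.det = 0 := by
  by_contra! hdet
  obtain ⟨⟨M, hMK⟩, hM⟩ := Module.finrank_pos_iff_exists_ne_zero.mp (Nat.zero_lt_of_lt hK)
  have hMdet : IsUnit M.det := (hdet M hMK fun h => hM (Subtype.ext h)).isUnit
  refine hK.not_ge (finrank_le_one ⟨M, hMK⟩ fun ⟨N, hNK⟩ => ?_)
  -- For an eigenvalue `μ` of `N * M⁻¹` the matrix `μ • M - N` of `K` is singular, hence zero.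
  obtain ⟨μ, hμ⟩ := spectrum.nonempty_of_isAlgClosed_of_finiteDimensional 𝕜 (N * M⁻¹)
  have hfactor : μ • M - N = (algebraMap 𝕜 _ μ - N * M⁻¹) * M := by
    rw [sub_mul, Matrix.nonsing_inv_mul_cancel_right M N hMdet, ← Algebra.smul_def]
  refine ⟨μ, Subtype.ext (sub_eq_zero.mp ?_)⟩
  by_contra hne
  refine hdet _ (K.sub_mem (K.smul_mem μ hMK) hNK) hne ?_
  rw [hfactor, Matrix.det_mul, mul_eq_zero, or_iff_left hMdet.ne_zero]
  by_contra hunit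
  exact hμ ((Matrix.isUnit_iff_isUnit_det _).mpr (Ne.isUnit hunit))

theorem IsEntangled.det_ne_zero {ψ : Fin 2 × Fin 2 → ℂ} (hψ : IsEntangled ψ) :
    (Matrix.of fun i j => star ψ (i, j)).det ≠ 0 := by
  intro hdet
  obtain ⟨α, β, hαβ⟩ := exists_eq_vecMulVec_of_rank_le_one
    (Nat.le_of_lt_succ (rank_lt_card_of_det_eq_zero hdet))
  refine hψ ⟨star α, star β, fun i j => star_injective ?_⟩
  simpa [Matrix.vecMulVec_apply] using congrFun₂ hαβ i j

theorem exists_vecMulVec_vanishing_on_ker {𝕜 : Type*} [Field 𝕜] [IsAlgClosed 𝕜]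
    {T : Matrix (Fin 2 × Fin 2) (Fin 2 × Fin 2) 𝕜} (hT : 1 < T.rank) :
    ∃ α β : Fin 2 → 𝕜, α ≠ 0 ∧ β ≠ 0 ∧
      ∀ φ, T.mulVec φ = 0 → ∑ i, ∑ j, Matrix.vecMulVec α β i j * φ (i, j) = 0 := by
  let toMatrix := LinearEquiv.curry 𝕜 𝕜 (Fin 2) (Fin 2) ≪≫ₗ Matrix.ofLinearEquiv 𝕜
  obtain ⟨M, ⟨_, ⟨u, rfl⟩, rfl⟩, hM, hdet⟩ := exists_mem_ne_zero_and_det_eq_zero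
    (K := (LinearMap.range T.transpose.mulVecLin).map toMatrix.toLinearMap)
    (by rwa [LinearEquiv.finrank_map_eq, ← Matrix.rank, Matrix.rank_transpose])
  obtain ⟨α, β, hαβ⟩ := exists_eq_vecMulVec_of_rank_le_one
    (Nat.le_of_lt_succ (rank_lt_card_of_det_eq_zero hdet))
  refine ⟨α, β, ?_, ?_, fun φ hφ => ?_⟩
  · rintro rfl
    exact hM (hαβ.trans (Matrix.zero_vecMulVec β))
  · rintro rfl
    exact hM (hαβ.trans (Matrix.vecMulVec_zero α))
  · have hrow : T.transpose.mulVec u ⬝ᵥ φ = 0 := by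
      rw [Matrix.mulVec_transpose, ← Matrix.dotProduct_mulVec, hφ, dotProduct_zero]
    rw [← hαβ]
    exact (Fintype.sum_prod_type _).symm.trans hrow

end TwoSpin

/-! ### Two-spin operators embedded in a spin system -/

section Embed

variable {W : Type*} [DecidableEq W]

theorem cut_sliceSite (A : Finset W) (a : A) (i : Fin 2) (Φ : (W → Fin 2) → ℂ) (x : A → Fin 2)
    (y : {v : W // v ∉ A} → Fin 2) :
    cut A (sliceSite (a : W) i Φ) (x, y) = cut A Φ (Function.update x a i, y) := by
  refine congrArg Φ (funext fun v => ?_)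
  by_cases hva : v = a
  · subst hva
    simp
  · have hne (hv : v ∈ A) : (⟨v, hv⟩ : A) ≠ a := fun h => hva (congrArg Subtype.val h)
    simp [hva, hne]

variable [Fintype W]

theorem embedPair_mulVec_apply {a b : W} (hab : a ≠ b)
    (T : Matrix (Fin 2 × Fin 2) (Fin 2 × Fin 2) ℂ) (Φ : (W → Fin 2) → ℂ) (x : W → Fin 2) :
    (embedPair a b T).mulVec Φ x =
      T.mulVec (fun p => sliceSite a p.1 (sliceSite b p.2 Φ) x) (x a, x b) := by
  let place (p : Fin 2 × Fin 2) : W → Fin 2 := Function.update (Function.update x a p.1) b p.2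
  have place_left (p) : place p a = p.1 := by simp [place, hab]
  have place_right (p) : place p b = p.2 := by simp [place]
  have place_of_ne (p) {c : W} (hca : c ≠ a) (hcb : c ≠ b) : place p c = x c := by
    simp [place, hca, hcb]
  simp only [Matrix.mulVec, dotProduct]
  refine (Finset.sum_of_injOn place (fun p _ q _ hpq => ?_)
    (fun _ _ => Finset.mem_coe.mpr (Finset.mem_univ _)) (fun y _ hy => ?_) (fun p _ => ?_)).symm
  · exact Prod.ext (by rw [← place_left p, hpq, place_left])
      (by rw [← place_right p, hpq, place_right])
  · rw [embedPair, if_neg, zero_mul]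
    refine fun hxy => hy ⟨(y a, y b), Finset.mem_coe.mpr (Finset.mem_univ _), funext fun c => ?_⟩
    by_cases hca : c = a
    · rw [hca, place_left]
    by_cases hcb : c = b
    · rw [hcb, place_right]
    rw [place_of_ne _ hca hcb, hxy c hca hcb]
  · rw [embedPair, if_pos fun c hca hcb => (place_of_ne p hca hcb).symm, place_left, place_right]
    rfl

theorem embedPair_zero (a b : W) : embedPair a b 0 = 0 := by
  ext x y
  simp [embedPair]

theorem mulVec_sliceSite_eq_zero {a b : W} (hab : a ≠ b)
    {T : Matrix (Fin 2 × Fin 2) (Fin 2 × Fin 2) ℂ} {Φ : (W → Fin 2) → ℂ}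
    (hΦ : (embedPair a b T).mulVec Φ = 0) (x : W → Fin 2) :
    T.mulVec (fun p => sliceSite a p.1 (sliceSite b p.2 Φ) x) = 0 := by
  ext ⟨i, j⟩
  have h := congrFun hΦ (Function.update (Function.update x a i) b j)
  rw [embedPair_mulVec_apply hab] at h
  simpa [sliceSite_apply, hab, Function.update_comm hab] using h

theorem contractPair_eq_zero_of_embedPair_mulVec_eq_zero {a b : W} (hab : a ≠ b)
    {T : Matrix (Fin 2 × Fin 2) (Fin 2 × Fin 2) ℂ} {M : Matrix (Fin 2) (Fin 2) ℂ}
    (hM : ∀ φ, T.mulVec φ = 0 → ∑ i, ∑ j, M i j * φ (i, j) = 0) {Φ : (W → Fin 2) → ℂ}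
    (hΦ : (embedPair a b T).mulVec Φ = 0) : contractPair a b M Φ = 0 := by
  ext x
  simpa only [contractPair_apply, Finset.sum_apply, Pi.smul_apply, Pi.zero_apply, smul_eq_mul]
    using hM _ (mulVec_sliceSite_eq_zero hab hΦ x)

theorem embedPair_posSemidef (a b : W) {T : Matrix (Fin 2 × Fin 2) (Fin 2 × Fin 2) ℂ}
    (hT : T.PosSemidef) : (embedPair a b T).PosSemidef := by
  let split (x : W → Fin 2) : (Fin 2 × Fin 2) × ({c : W // c ≠ a ∧ c ≠ b} → Fin 2) :=
    ((x a, x b), fun c => x c)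
  have hsplit : embedPair a b T = (Matrix.kroneckerMap (· * ·) T 1).submatrix split split := by
    ext x y
    simp only [embedPair, split, Matrix.submatrix_apply, Matrix.kroneckerMap_apply,
      Matrix.one_apply, mul_ite, mul_one, mul_zero, funext_iff, Subtype.forall, and_imp]
  rw [hsplit]
  exact (hT.kronecker Matrix.PosSemidef.one).submatrix split

theorem embedPair_mulVec_cut {A : Finset W} {a b : A} (hab : a ≠ b)
    (T : Matrix (Fin 2 × Fin 2) (Fin 2 × Fin 2) ℂ) (Φ : (W → Fin 2) → ℂ)
    (y : {v : W // v ∉ A} → Fin 2) :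
    (embedPair a b T).mulVec (fun x => cut A Φ (x, y)) =
      fun x => cut A ((embedPair (a : W) b T).mulVec Φ) (x, y) := by
  have hslice (p : Fin 2 × Fin 2) (x : A → Fin 2) :
      sliceSite a p.1 (sliceSite b p.2 fun x => cut A Φ (x, y)) x =
        cut A (sliceSite (a : W) p.1 (sliceSite (b : W) p.2 Φ)) (x, y) := by
    rw [cut_sliceSite, cut_sliceSite]
    rfl
  ext x
  rw [embedPair_mulVec_apply hab, cut, embedPair_mulVec_apply (Subtype.coe_ne_coe.mpr hab)]
  simp only [hslice, Finset.coe_mem, dite_true, Subtype.coe_eta]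
  rfl

end Embed

/-! ### The kernel of a connected Hamiltonian -/

theorem sum_mulVec_eq_zero_iff_of_posSemidef {ι n 𝕜 : Type*} [Fintype n] [RCLike 𝕜] {s : Finset ι}
    {F : ι → Matrix n n 𝕜} (hF : ∀ i ∈ s, (F i).PosSemidef) (x : n → 𝕜) :
    (∑ i ∈ s, F i).mulVec x = 0 ↔ ∀ i ∈ s, (F i).mulVec x = 0 := by
  rw [← (Matrix.posSemidef_sum s hF).dotProduct_mulVec_zero_iff, Matrix.sum_mulVec, dotProduct_sum,
    Finset.sum_eq_zero_iff_of_nonneg fun i hi => (hF i hi).dotProduct_mulVec_nonneg x]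
  exact forall₂_congr fun i hi => (hF i hi).dotProduct_mulVec_zero_iff x

namespace PairHamiltonian

/-- A Hamiltonian each of whose terms is positive semidefinite and, unless it is zero, has an
entangled excited state: a natural Hamiltonian without the conditions on its interaction graph and
on the ground energies. Unlike naturalness, this notion passes to all subsystems. -/
structure IsEntangling {V : Type*} (H : PairHamiltonian V) : Prop where
  posSemidef : ∀ a b, (H.term a b).PosSemidef
  entangled_excited : ∀ a b, H.term a b ≠ 0 →
    ∃ ψ : Fin 2 × Fin 2 → ℂ, IsEntangled ψ ∧ ∀ φ, (H.term a b).mulVec φ = 0 → star φ ⬝ᵥ ψ = 0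

theorem IsNatural.isEntangling_restrict {V : Type*} {H : PairHamiltonian V} (hH : H.IsNatural)
    (A : Finset V) : (H.restrict A).IsEntangling :=
  ⟨fun a b => hH.posSemidef a b, fun a b => hH.entangled_excited a b⟩

variable {W : Type*} [Fintype W] [DecidableEq W] {H : PairHamiltonian W}

theorem op_mulVec_eq_zero_iff (hpos : ∀ a b, (H.term a b).PosSemidef) (Φ : (W → Fin 2) → ℂ) :
    H.op.mulVec Φ = 0 ↔ ∀ a b, (embedPair a b (H.term a b)).mulVec Φ = 0 := by
  rw [op, sum_mulVec_eq_zero_iff_of_posSemidef fun e _ => ?_]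
  · simp only [Finset.mem_univ, true_imp_iff, Sym2.forall, Sym2.lift_mk]
  · induction e with
    | _ a b => exact embedPair_posSemidef a b (hpos a b)

theorem ker_op_le_ker_contractPair (hpos : ∀ a b, (H.term a b).PosSemidef) {a b : W} (hab : a ≠ b)
    {M : Matrix (Fin 2) (Fin 2) ℂ}
    (hM : ∀ φ, (H.term a b).mulVec φ = 0 → ∑ i, ∑ j, M i j * φ (i, j) = 0) :
    LinearMap.ker H.op.mulVecLin ≤ LinearMap.ker (contractPair a b M) := fun Φ hΦ =>
  contractPair_eq_zero_of_embedPair_mulVec_eq_zero hab hM ((op_mulVec_eq_zero_iff hpos Φ).mp hΦ a b)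

theorem IsEntangling.isPairConstrained_ker_op (hH : H.IsEntangling)
    (hconn : H.interactionGraph.Preconnected) :
    IsPairConstrained Finset.univ (LinearMap.ker H.op.mulVecLin) := by
  refine isPairConstrained_of_preconnected hconn fun a b hab => ?_
  obtain ⟨ψ, hψ, hker⟩ := hH.entangled_excited a b hab
  refine ⟨_, hψ.det_ne_zero, ker_op_le_ker_contractPair hH.posSemidef hab.ne fun φ hφ => ?_⟩
  have hzero : star ψ ⬝ᵥ φ = 0 := by
    rw [Matrix.star_dotProduct, hker φ hφ, star_zero]
  simpa only [dotProduct, Fintype.sum_prod_type, Matrix.of_apply] using hzero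

theorem IsEntangling.finrank_ker_op_le_card_add_one (hH : H.IsEntangling)
    (hconn : H.interactionGraph.Preconnected) :
    Module.finrank ℂ (LinearMap.ker H.op.mulVecLin) ≤ Fintype.card W + 1 :=
  (hH.isPairConstrained_ker_op hconn).finrank_le_card_add_one

theorem IsEntangling.finrank_ker_op_le_two (hH : H.IsEntangling)
    (hconn : H.interactionGraph.Preconnected) (hheavy : H.heavyGraph ≠ ⊥) :
    Module.finrank ℂ (LinearMap.ker H.op.mulVecLin) ≤ 2 := by
  obtain ⟨a, b, hab⟩ := SimpleGraph.ne_bot_iff_exists_adj.mp hheavy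
  have hrank : 1 < (H.term a b).rank := by
    rcases hab with h | h <;> omega
  obtain ⟨α, β, hα, hβ, hαβ⟩ := exists_vecMulVec_vanishing_on_ker hrank
  exact (hH.isPairConstrained_ker_op hconn).finrank_le_two (Finset.mem_univ a) (Finset.mem_univ b)
    hab.ne hα hβ (ker_op_le_ker_contractPair hH.posSemidef hab.ne hαβ)

theorem reducedSpace_le_ker_op_restrict {A : Finset W}
    (hpos : ∀ a b, ((H.restrict A).term a b).PosSemidef) {M : Submodule ℂ ((W → Fin 2) → ℂ)}
    (hM : ∀ Φ ∈ M, ∀ a ∈ A, ∀ b ∈ A, (embedPair a b (H.term a b)).mulVec Φ = 0) :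
    reducedSpace A M ≤ LinearMap.ker (H.restrict A).op.mulVecLin := by
  refine iSup₂_le fun Φ hΦ => ?_
  rw [Matrix.range_mulVecLin, Submodule.span_le]
  rintro _ ⟨y, rfl⟩
  refine (op_mulVec_eq_zero_iff hpos _).mpr fun a b => ?_
  rcases eq_or_ne a b with rfl | hab
  · rw [(H.restrict A).term_self, embedPair_zero, Matrix.zero_mulVec]
  · exact (embedPair_mulVec_cut hab _ Φ y).trans
      (funext fun _ => congrFun (hM Φ hΦ a a.2 b b.2) _)

theorem card_le_or_heavyGraph_ne_bot {V : Type*} {H : PairHamiltonian V} {A : Finset V} {β : ℕ}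
    (hβ : H.heavyComponents A ≤ β) :
    A.card ≤ β ∨ 1 ≤ β ∧ (H.restrict A).heavyGraph ≠ ⊥ := by
  rcases eq_or_ne (H.restrict A).heavyGraph ⊥ with hbot | hne
  · refine Or.inl (le_trans ?_ hβ)
    rw [← Fintype.card_coe, ← Nat.card_eq_fintype_card, heavyComponents, hbot]
    exact Nat.card_le_card_of_injective (SimpleGraph.connectedComponentMk ⊥) fun a b hab =>
      SimpleGraph.reachable_bot.mp (SimpleGraph.ConnectedComponent.exact hab)
  · obtain ⟨a, -⟩ := SimpleGraph.ne_bot_iff_exists_adj.mp hne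
    have : Nonempty (H.restrict A).heavyGraph.ConnectedComponent :=
      ⟨(H.restrict A).heavyGraph.connectedComponentMk a⟩
    exact Or.inr ⟨Nat.card_pos.trans_le hβ, hne⟩

theorem heavyComponents_le_one {V : Type*} {H : PairHamiltonian V} {A : Finset V}
    (hA : H.IsContiguous A)
    (hheavy : ∀ a b, H.term a b ≠ 0 → (H.term a b).rank = 2 ∨ (H.term a b).rank = 3) :
    H.heavyComponents A ≤ 1 := by
  have hle : (H.restrict A).interactionGraph ≤ (H.restrict A).heavyGraph :=
    fun a b hab => hheavy a b hab
  have := (hA.mono hle).subsingleton_connectedComponent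
  exact Finite.card_le_one_iff_subsingleton.mpr this

end PairHamiltonian

/-! ### Entanglement entropy and entanglement of formation -/

section Entropy

theorem sum_negMulLog_le_log_card {ι : Type*} {s : Finset ι} {p : ι → ℝ} (hp : ∀ i ∈ s, 0 ≤ p i)
    (hsum : ∑ i ∈ s, p i = 1) : ∑ i ∈ s, Real.negMulLog (p i) ≤ Real.log s.card := by
  have hcard : 0 < (s.card : ℝ) := by
    rw [Nat.cast_pos, Finset.card_pos]
    exact Finset.nonempty_of_sum_ne_zero (hsum.trans_ne one_ne_zero)
  have jensen := Real.concaveOn_negMulLog.le_map_sum (w := fun _ => (s.card : ℝ)⁻¹)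
    (fun _ _ => inv_nonneg.mpr hcard.le) (by simp [hcard.ne']) hp
  simp only [smul_eq_mul, ← Finset.mul_sum, hsum, mul_one, Real.negMulLog_def, Real.log_inv,
    neg_mul_neg] at jensen
  exact le_of_mul_le_mul_left jensen (inv_pos.mpr hcard)

theorem sum_negMulLog_le_log_card_support {ι : Type*} [Fintype ι] {p : ι → ℝ} (hp : ∀ i, 0 ≤ p i)
    (hsum : ∑ i, p i = 1) :
    ∑ i, Real.negMulLog (p i) ≤ Real.log (Fintype.card {i // p i ≠ 0}) := by
  classical
  rw [Fintype.card_subtype, ← Finset.sum_filter_of_ne (p := fun i => p i ≠ 0) fun i _ hi h => by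
    simp [h] at hi]
  exact sum_negMulLog_le_log_card (fun i _ => hp i) ((Finset.sum_filter_ne_zero _).trans hsum)

theorem logb_natCast_mono {b : ℝ} (hb : 1 < b) {k l : ℕ} (h : k ≤ l) :
    Real.logb b k ≤ Real.logb b l := by
  rcases k.eq_zero_or_pos with rfl | hk
  · rcases l.eq_zero_or_pos with rfl | hl
    · rfl
    · simpa using Real.logb_nonneg hb (Nat.one_le_cast.mpr hl)
  · exact Real.logb_le_logb_of_le hb (Nat.cast_pos.mpr hk) (Nat.cast_le.mpr h)

theorem exists_smul_eq_and_star_dotProduct_self_eq_one {ι 𝕜 : Type*} [Fintype ι] [RCLike 𝕜]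
    {w : ι → 𝕜} (hw : w ≠ 0) :
    ∃ c : ℝ, ∃ ψ : ι → 𝕜, (c : 𝕜) • ψ = w ∧ c ≠ 0 ∧ star ψ ⬝ᵥ ψ = 1 := by
  have hc : ‖WithLp.toLp 2 w‖ ≠ 0 := by simpa using hw
  have hc' : (‖WithLp.toLp 2 w‖ : 𝕜) ≠ 0 := RCLike.ofReal_ne_zero.mpr hc
  have hnorm : star w ⬝ᵥ w = (‖WithLp.toLp 2 w‖ : 𝕜) ^ 2 := by
    rw [← inner_self_eq_norm_sq_to_K (𝕜 := 𝕜), EuclideanSpace.inner_toLp_toLp, dotProduct_comm]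
  refine ⟨_, (‖WithLp.toLp 2 w‖ : 𝕜)⁻¹ • w, smul_inv_smul₀ hc' w, hc, ?_⟩
  rw [star_smul, smul_dotProduct, dotProduct_smul, hnorm, star_inv₀, RCLike.star_def,
    RCLike.conj_ofReal, smul_eq_mul, smul_eq_mul]
  field_simp

variable {m n : Type*} [Fintype m] [Fintype n]

theorem trace_coeffMatrix_mul_conjTranspose (ψ : m × n → ℂ) :
    (coeffMatrix ψ * (coeffMatrix ψ).conjTranspose).trace = star ψ ⬝ᵥ ψ := by
  simp only [Matrix.trace, Matrix.diag_apply, Matrix.mul_apply, Matrix.conjTranspose_apply,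
    coeffMatrix, dotProduct, Fintype.sum_prod_type, Pi.star_apply, mul_comm]

variable [DecidableEq m]

theorem sum_eigenvalues_coeffMatrix {ψ : m × n → ℂ} (hψ : star ψ ⬝ᵥ ψ = 1) :
    ∑ i, (Matrix.isHermitian_mul_conjTranspose_self (coeffMatrix ψ)).eigenvalues i = 1 := by
  have h := (Matrix.isHermitian_mul_conjTranspose_self (coeffMatrix ψ)).trace_eq_sum_eigenvalues
  rw [trace_coeffMatrix_mul_conjTranspose, hψ] at h
  exact Complex.ofReal_injective (by simpa using h.symm)

theorem eigenvalues_coeffMatrix_nonneg (ψ : m × n → ℂ) (i : m) :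
    0 ≤ (Matrix.isHermitian_mul_conjTranspose_self (coeffMatrix ψ)).eigenvalues i :=
  (Matrix.posSemidef_self_mul_conjTranspose (coeffMatrix ψ)).eigenvalues_nonneg i

theorem entanglementEntropy_nonneg {ψ : m × n → ℂ} (hψ : star ψ ⬝ᵥ ψ = 1) :
    0 ≤ entanglementEntropy ψ := by
  refine Finset.sum_nonneg fun i _ => div_nonneg (Real.negMulLog_nonneg
    (eigenvalues_coeffMatrix_nonneg ψ i) ?_) (Real.log_nonneg one_le_two)
  rw [← sum_eigenvalues_coeffMatrix hψ]
  exact Finset.single_le_sum (fun j _ => eigenvalues_coeffMatrix_nonneg ψ j) (Finset.mem_univ i)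

theorem entanglementEntropy_le_schmidtMeasure {ψ : m × n → ℂ} (hψ : star ψ ⬝ᵥ ψ = 1) :
    entanglementEntropy ψ ≤ schmidtMeasure ψ := by
  have h := sum_negMulLog_le_log_card_support (eigenvalues_coeffMatrix_nonneg ψ)
    (sum_eigenvalues_coeffMatrix hψ)
  rw [← Matrix.IsHermitian.rank_eq_card_non_zero_eigs, Matrix.rank_self_mul_conjTranspose] at h
  rw [entanglementEntropy, ← Finset.sum_div, schmidtMeasure, Real.logb]
  gcongr

theorem entanglementOfFormation_le_sum {ι : Type*} [Fintype ι] {p : ι → ℝ} {ψ : ι → m × n → ℂ}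
    (hp : ∀ i, 0 ≤ p i) (hsum : ∑ i, p i = 1) (hψ : ∀ i, star (ψ i) ⬝ᵥ ψ i = 1) :
    entanglementOfFormation (∑ i, (p i : ℂ) • Matrix.vecMulVec (ψ i) (star (ψ i))) ≤
      ∑ i, p i * entanglementEntropy (ψ i) := by
  let e := (Fintype.equivFin ι).symm
  refine csInf_le ⟨0, ?_⟩ ⟨Fintype.card ι, p ∘ e, ψ ∘ e, fun i => hp _, (e.sum_comp p).trans hsum,
    fun i => hψ _, (e.sum_comp fun i => (p i : ℂ) • Matrix.vecMulVec (ψ i) (star (ψ i))).symm,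
    (e.sum_comp fun i => p i * entanglementEntropy (ψ i)).symm⟩
  rintro _ ⟨k, q, φ, hq, -, hφ, -, rfl⟩
  exact Finset.sum_nonneg fun i _ => mul_nonneg (hq i) (entanglementEntropy_nonneg (hφ i))

theorem entanglementOfFormation_le_of_ne_zero {ι : Type*} [Fintype ι] {w : ι → m × n → ℂ} {r : ℕ}
    (hw : ∀ i, w i ≠ 0) (hrank : ∀ i, (coeffMatrix (w i)).rank ≤ r)
    (htr : (∑ i, Matrix.vecMulVec (w i) (star (w i))).trace = 1) :
    entanglementOfFormation (∑ i, Matrix.vecMulVec (w i) (star (w i))) ≤ Real.logb 2 r := by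
  choose c ψ hcψ hc hψ using fun i => exists_smul_eq_and_star_dotProduct_self_eq_one (hw i)
  have hpure (i : ι) : Matrix.vecMulVec (w i) (star (w i)) =
      ((c i ^ 2 : ℝ) : ℂ) • Matrix.vecMulVec (ψ i) (star (ψ i)) := by
    rw [← hcψ i, star_smul, Matrix.smul_vecMulVec, Matrix.vecMulVec_smul, smul_smul]
    simp [sq]
  have hrankψ (i : ι) : (coeffMatrix (ψ i)).rank ≤ r := by
    have hci : (c i : ℂ) ≠ 0 := RCLike.ofReal_ne_zero.mpr (hc i)
    rw [← Matrix.rank_smul_of_mem_nonZeroDivisors _ (mem_nonZeroDivisors_of_ne_zero hci)]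
    exact (congrArg (fun v => (coeffMatrix v).rank) (hcψ i)).trans_le (hrank i)
  simp only [hpure] at htr ⊢
  have hsum : ∑ i, c i ^ 2 = 1 := by
    simp only [Matrix.trace_sum, Matrix.trace_smul, Matrix.trace_vecMulVec,
      dotProduct_comm (ψ _), hψ, smul_eq_mul, mul_one] at htr
    exact_mod_cast htr
  calc entanglementOfFormation (∑ i, ((c i ^ 2 : ℝ) : ℂ) • Matrix.vecMulVec (ψ i) (star (ψ i)))
      ≤ ∑ i, c i ^ 2 * entanglementEntropy (ψ i) :=
        entanglementOfFormation_le_sum (fun i => sq_nonneg (c i)) hsum hψ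
    _ ≤ ∑ i, c i ^ 2 * Real.logb 2 r :=
        Finset.sum_le_sum fun i _ => mul_le_mul_of_nonneg_left
          ((entanglementEntropy_le_schmidtMeasure (hψ i)).trans
            (logb_natCast_mono one_lt_two (hrankψ i))) (sq_nonneg (c i))
    _ = Real.logb 2 r := by rw [← Finset.sum_mul, hsum, one_mul]

theorem entanglementOfFormation_le_logb {ι : Type*} [Fintype ι] {w : ι → m × n → ℂ} {r : ℕ}
    (hrank : ∀ i, (coeffMatrix (w i)).rank ≤ r)
    (htr : (∑ i, Matrix.vecMulVec (w i) (star (w i))).trace = 1) :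
    entanglementOfFormation (∑ i, Matrix.vecMulVec (w i) (star (w i))) ≤ Real.logb 2 r := by
  classical
  have hsum : ∑ i, Matrix.vecMulVec (w i) (star (w i)) =
      ∑ i : {i // w i ≠ 0}, Matrix.vecMulVec (w i) (star (w i)) := by
    rw [← Finset.sum_subtype _ (fun i => Finset.mem_filter_univ i)
      fun i => Matrix.vecMulVec (w i) (star (w i))]
    refine (Finset.sum_filter_of_ne fun i _ hne => ?_).symm
    exact fun hzero => hne (by rw [hzero, Matrix.zero_vecMulVec])
  rw [hsum] at htr ⊢
  exact entanglementOfFormation_le_of_ne_zero (fun i => i.2) (fun i => hrank i) htr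

end Entropy

/-! ### Reductions to subsystems -/

section Reductions

theorem range_mulVecLin_self_mul_conjTranspose {m n 𝕜 : Type*} [Fintype m] [Fintype n] [RCLike 𝕜]
    (B : Matrix m n 𝕜) :
    LinearMap.range (B * B.conjTranspose).mulVecLin = LinearMap.range B.mulVecLin := by
  refine Submodule.eq_of_le_of_finrank_eq ?_ (Matrix.rank_self_mul_conjTranspose B)
  rw [Matrix.mulVecLin_mul]
  exact LinearMap.range_comp_le_range _ _

theorem exists_eq_sum_vecMulVec_mem_range {n 𝕜 : Type*} [Fintype n] [RCLike 𝕜] {ρ : Matrix n n 𝕜}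
    (hρ : ρ.PosSemidef) :
    ∃ (k : ℕ) (v : Fin k → n → 𝕜), (∀ i, v i ∈ LinearMap.range ρ.mulVecLin) ∧
      ρ = ∑ i, Matrix.vecMulVec (v i) (star (v i)) := by
  obtain ⟨k, v, hv⟩ := Matrix.posSemidef_iff_eq_sum_vecMulVec.mp hρ
  let B : Matrix n (Fin k) 𝕜 := Matrix.of fun x i => v i x
  have hB : ρ = B * B.conjTranspose := by
    ext x y
    simp [hv, B, Matrix.sum_apply, Matrix.mul_apply, Matrix.vecMulVec_apply]
  refine ⟨k, v, fun i => ?_, hv⟩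
  rw [hB, range_mulVecLin_self_mul_conjTranspose, Matrix.range_mulVecLin]
  exact Submodule.subset_span ⟨i, rfl⟩

variable {V : Type*} [DecidableEq V] {A C : Finset V}

theorem glue_bijective (hAC : Disjoint A C) :
    Function.Bijective fun q : ((A → Fin 2) × (C → Fin 2)) × ({v : V // v ∉ A ∧ v ∉ C} → Fin 2) =>
      glue A C q.1 q.2 := by
  refine Function.bijective_iff_has_inverse.mpr
    ⟨fun x => ((fun v => x v, fun v => x v), fun v => x v), ?_, fun x => funext fun v => ?_⟩
  · rintro ⟨⟨x, y⟩, z⟩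
    refine Prod.ext (Prod.ext ?_ ?_) ?_ <;> funext ⟨v, hv⟩
    · simp [glue, hv]
    · simp [glue, hv, Finset.disjoint_right.mp hAC hv]
    · simp [glue, hv]
  · simp only [glue]
    split_ifs <;> rfl

theorem coeffMatrix_glue (Φ : (V → Fin 2) → ℂ) (z : {v : V // v ∉ A ∧ v ∉ C} → Fin 2) :
    (coeffMatrix fun p : (A → Fin 2) × (C → Fin 2) => Φ (glue A C p z)) =
      (coeffMatrix (cut A Φ)).submatrix id
        fun y v => if hv : v.1 ∈ C then y ⟨v, hv⟩ else z ⟨v, v.2, hv⟩ :=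
  rfl

variable [Fintype V]

theorem trace_reducedState (hAC : Disjoint A C) (ρ : Matrix (V → Fin 2) (V → Fin 2) ℂ) :
    (reducedState A C ρ).trace = ρ.trace := by
  simp only [Matrix.trace, Matrix.diag_apply, reducedState]
  rw [← Fintype.sum_prod_type']
  exact (glue_bijective hAC).sum_comp fun x => ρ x x

theorem reducedState_sum_vecMulVec {ι : Type*} [Fintype ι] (A C : Finset V)
    (v : ι → (V → Fin 2) → ℂ) :
    reducedState A C (∑ k, Matrix.vecMulVec (v k) (star (v k))) =
      ∑ q : ι × ({v : V // v ∉ A ∧ v ∉ C} → Fin 2),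
        Matrix.vecMulVec (fun p => v q.1 (glue A C p q.2))
          (star fun p => v q.1 (glue A C p q.2)) := by
  ext p p'
  simp only [reducedState, Matrix.sum_apply, Matrix.vecMulVec_apply, Pi.star_apply,
    Fintype.sum_prod_type]
  exact Finset.sum_comm

variable {M : Submodule ℂ ((V → Fin 2) → ℂ)}

theorem rank_coeffMatrix_cut_le {Φ : (V → Fin 2) → ℂ} (hΦ : Φ ∈ M) :
    (coeffMatrix (cut A Φ)).rank ≤ Module.finrank ℂ (reducedSpace A M) :=
  Submodule.finrank_mono (le_iSup₂_of_le Φ hΦ le_rfl)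

theorem IsStateOn.entanglementOfFormation_reducedState_le
    {ρ : Matrix (V → Fin 2) (V → Fin 2) ℂ} (hρ : IsStateOn M ρ) (hAC : Disjoint A C) :
    entanglementOfFormation (reducedState A C ρ) ≤
      Real.logb 2 (Module.finrank ℂ (reducedSpace A M)) := by
  obtain ⟨k, v, hv, hsum⟩ := exists_eq_sum_vecMulVec_mem_range hρ.posSemidef
  have hvM (i : Fin k) : v i ∈ M := by
    obtain ⟨φ, hφ⟩ := hv i
    exact hφ ▸ hρ.support φ
  have htr : (reducedState A C ρ).trace = 1 := (trace_reducedState hAC ρ).trans hρ.trace_one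
  rw [hsum, reducedState_sum_vecMulVec] at htr ⊢
  refine entanglementOfFormation_le_logb (fun q => ?_) htr
  rw [coeffMatrix_glue]
  exact (Matrix.rank_submatrix_le _ _ _).trans (rank_coeffMatrix_cut_le (hvM q.1))

end Reductions

theorem mainTheorem5_general {V : Type*} [Fintype V] [DecidableEq V] (H : PairHamiltonian V)
    (A : Finset V) (hH : (H.restrict A).IsEntangling) (hA : H.IsContiguous A)
    (M : Submodule ℂ ((V → Fin 2) → ℂ))
    (hM : ∀ Φ ∈ M, ∀ a ∈ A, ∀ b ∈ A, (embedPair a b (H.term a b)).mulVec Φ = 0) {β : ℕ}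
    (hβ : A.card ≤ β ∨ 1 ≤ β ∧ (H.restrict A).heavyGraph ≠ ⊥) :
    Real.logb 2 (Module.finrank ℂ (LinearMap.ker (H.restrict A).op.mulVecLin))
        ≤ Real.logb 2 (β + 1) ∧
    Real.logb 2 (Module.finrank ℂ (reducedSpace A M)) ≤ Real.logb 2 (β + 1) ∧
    (∀ Φ ∈ M, schmidtMeasure (cut A Φ) ≤ Real.logb 2 (β + 1)) ∧
    (∀ ρ, IsStateOn M ρ → ∀ C : Finset V, Disjoint A C →
      entanglementOfFormation (reducedState A C ρ) ≤ Real.logb 2 (β + 1)) := by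
  have hlog {k : ℕ} (hk : k ≤ β + 1) : Real.logb 2 k ≤ Real.logb 2 (β + 1) := by
    exact_mod_cast logb_natCast_mono one_lt_two hk
  have hker : Module.finrank ℂ (LinearMap.ker (H.restrict A).op.mulVecLin) ≤ β + 1 := by
    rcases hβ with hcard | ⟨hone, hheavy⟩
    · have := hH.finrank_ker_op_le_card_add_one hA
      rw [Fintype.card_coe] at this
      omega
    · exact (hH.finrank_ker_op_le_two hA hheavy).trans (Nat.succ_le_succ hone)
  have hred : Module.finrank ℂ (reducedSpace A M) ≤ β + 1 := (Submodule.finrank_mono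
    (PairHamiltonian.reducedSpace_le_ker_op_restrict hH.posSemidef hM)).trans hker
  exact ⟨hlog hker, hlog hred, fun Φ hΦ => hlog ((rank_coeffMatrix_cut_le hΦ).trans hred),
    fun ρ hρ C hAC => (hρ.entanglementOfFormation_reducedState_le hAC).trans (hlog hred)⟩

theorem mainTheorem5 {V : Type*} [Fintype V] [DecidableEq V] (H : PairHamiltonian V)
    (hnat : H.IsNatural) (hff : H.IsFrustrationFree)
    (A : Finset V) (hA : H.IsContiguous A) :
    (∀ β : ℕ, H.heavyComponents A ≤ β →
      Real.logb 2 (Module.finrank ℂ (LinearMap.ker (H.restrict A).op.mulVecLin))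
          ≤ Real.logb 2 (β + 1) ∧
      Real.logb 2 (Module.finrank ℂ (reducedSpace A H.groundSpace)) ≤ Real.logb 2 (β + 1) ∧
      (∀ Φ ∈ H.groundSpace, schmidtMeasure (cut A Φ) ≤ Real.logb 2 (β + 1)) ∧
      (∀ ρ, IsStateOn H.groundSpace ρ → ∀ C : Finset V, Disjoint A C →
        entanglementOfFormation (reducedState A C ρ) ≤ Real.logb 2 (β + 1))) ∧
    ((∀ a b, H.term a b ≠ 0 → (H.term a b).rank = 2 ∨ (H.term a b).rank = 3) →
      Real.logb 2 (Module.finrank ℂ (LinearMap.ker (H.restrict A).op.mulVecLin)) ≤ 1 ∧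
      Real.logb 2 (Module.finrank ℂ (reducedSpace A H.groundSpace)) ≤ 1 ∧
      (∀ Φ ∈ H.groundSpace, schmidtMeasure (cut A Φ) ≤ 1) ∧
      (∀ ρ, IsStateOn H.groundSpace ρ → ∀ C : Finset V, Disjoint A C →
        entanglementOfFormation (reducedState A C ρ) ≤ 1)) := by
  have bounds (β : ℕ) (hβ : H.heavyComponents A ≤ β) :=
    mainTheorem5_general H A (hnat.isEntangling_restrict A) hA H.groundSpace
      (fun Φ hΦ a _ b _ => hff Φ hΦ a b) (PairHamiltonian.card_le_or_heavyGraph_ne_bot hβ)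
  exact ⟨bounds, fun hheavy => by
    simpa [one_add_one_eq_two] using bounds 1 (PairHamiltonian.heavyComponents_le_one hA hheavy)⟩
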